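/- Let $q\ge 1$ and $P_{ij}\in\{0,1\}$ for $1\le i<j\le q$ (the parameters of the $(\mathbb Z_2)^q$ cocycle $\omega_2(g,g')=\exp(-i\pi\sum_{i<j}P_{ij}g_jg'_i)$). Consider a periodic chain of $L$ unit cells with $q$ spins $\tfrac12$ each, let $X^r_i,Z^r_i$ be the Pauli operators of spin $i$ in cell $r\in\mathbb Z/L$, acting on the basis states $|g\rangle$, $g^r_i\in\{0,1\}$, by $Z^r_i|g\rangle=(-1)^{g^r_i}|g\rangle$ and by flipping $g^r_i$, and let $$H_L=-\sum_{r}\sum_{\alpha=1}^q\mathcal O^r_\alpha,\qquad \mathcal O^r_\alpha=\begin{cases}\prod_{1<l\le q}(Z^{r+1}_lZ^r_l)^{P_{1l}}\,X^{r+1}_1&\alpha=1,\\[2pt]\prod_{\alpha<l\le q}(Z^{r+1}_lZ^r_l)^{P_{\alpha l}}\,X^{r+1}_\alpha\prod_{1\le k<\alpha}(Z^{r+2}_kZ^{r+1}_k)^{P_{k\alpha}}&1<\alpha<q,\\[2pt]X^r_q\prod_{1\le k<q}(Z^{r+1}_kZ^r_k)^{P_{kq}}&\alpha=q>1.\end{cases}$$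 (a) Let $T^{g_1\ldots g_q}$ ($g_i\in\{0,1\}$) be $D\times D$ complex matrices, independent of $L$, such that for all sufficiently large $L$ the matrix product state $\sum_{g}\mathrm{Tr}\big(\prod_{r=0}^{L-1}T^{g^r_1\ldots g^r_q}\big)|g\rangle$ is a (nonzero) ground state of $H_L$, and suppose that $D$ is the smallest bond dimension for which such matrices exist. Then every $T^{g_1\ldots g_q}$ that is not the zero matrix has rank exactly $1$. (b) Let $p_\alpha=2$ for $\alpha\in\{1,q\}$ and $p_\alpha=3$ otherwise, and write $\mathcal O^r_\alpha=o^r_{\alpha,1}\cdots o^r_{\alpha,p_\alpha}$, where $o^r_{\alpha,\tau}$ is the part of $\mathcal O^r_\alpha$ acting on cell $r+\tau-1$. For $1\le\tau\le p_\alpha-1$ put $\mathcal L^r_{\alpha,\tau}=o^r_{\alpha,1}\cdots o^r_{\alpha,\tau}$ (on an infinite chain), and let $\mathbf t$ be the matrix over $\mathbb Z/2$, indexed by the pairs $(\alpha,\tau)$, with $\mathcal L^{r-\tau+1}_{\alpha,\tau}\mathcal L^{r-\tau'+1}_{\alpha',\tau'}=(-1)^{\mathbf t_{(\alpha\tau),(\alpha'\tau')}}\mathcal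 L^{r-\tau'+1}_{\alpha',\tau'}\mathcal L^{r-\tau+1}_{\alpha,\tau}$. Let $D=2^{\mathrm{rank}(\mathbf t)/2}$, let $U_{\alpha,\tau}$ be invertible $D\times D$ complex matrices with $U_{\alpha,\tau}U_{\alpha',\tau'}=(-1)^{\mathbf t_{(\alpha\tau),(\alpha'\tau')}}U_{\alpha',\tau'}U_{\alpha,\tau}$, and let the $D\times D$ matrices $T^{g}$, $g=(g_1,\ldots,g_q)$, solve, for all $g$, all $\alpha$ and all $2\le\tau\le p_\alpha-1$, $$o_{\alpha,1}\circ T^g=T^gU_{\alpha,1},\qquad o_{\alpha,\tau}\circ T^g=U_{\alpha,\tau-1}^{-1}T^gU_{\alpha,\tau},\qquad o_{\alpha,p_\alpha}\circ T^g=U_{\alpha,p_\alpha-1}^{-1}T^g,$$ where $\circ$ is the action on the physical indices: $X_i\circ T^g=T^{g_1\ldots(1-g_i)\ldots g_q}$, $Z_i\circ T^g=(-1)^{g_i}T^g$. Then every $T^g$ that is not the zero matrix has rank exactly $1$. -/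

import Mathlib

namespace CocycleMPS

noncomputable section

/-! ### Pauli operators

A configuration of spins on the sites `ι` is `g : ι → ZMod 2`. A state with coefficients
`f g` is the function `f`. With `M = ℂ` these are wave functions; with `M` a space of matrices and
`ι` the spins of one unit cell, the same operators give the action `∘` on MPS matrices. -/

/-- `X_s |g⟩ = |…, 1 - g_s, …⟩`, written on coefficients. -/
def pauliX {ι M : Type*} [DecidableEq ι] [AddCommGroup M] [Module ℂ M] (s : ι) :
    Module.End ℂ ((ι → ZMod 2) → M) where
  toFun f := fun g => f (Function.update g s (1 - g s))
  map_add' _ _ := rfl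
  map_smul' _ _ := rfl

/-- `Z_s |g⟩ = (-1)^{g_s} |g⟩`, written on coefficients. -/
def pauliZ {ι M : Type*} [AddCommGroup M] [Module ℂ M] (s : ι) :
    Module.End ℂ ((ι → ZMod 2) → M) where
  toFun f := fun g => ((-1 : ℂ) ^ (g s).val) • f g
  map_add' f f' := by
    funext g
    simp [smul_add]
  map_smul' c f := by
    funext g
    simp [smul_smul, mul_comm]

/-! ### The cocycle Hamiltonian

A unit cell has `q = n + 1` spins, indexed by `Fin (n + 1)`; the first one is `0` and the last one
is `Fin.last n`. The cells form the ring `C`: `ZMod L` for a periodic chain of `L` cells, `ℤ` for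
the infinite chain. Only the entries `P i j` with `i < j` are ever used. -/

/-- States on the chain of cells `C`. -/
abbrev ChainState (C : Type*) (n : ℕ) : Type _ := (C × Fin (n + 1) → ZMod 2) → ℂ

/-- The stabilizer `O^r_α` of the `(ℤ₂)^q` cocycle model with parameters `P`. -/
def stabilizer {n : ℕ} (P : Fin (n + 1) → Fin (n + 1) → ZMod 2) (C : Type*) [CommRing C]
    [DecidableEq C] (r : C) (α : Fin (n + 1)) : Module.End ℂ (ChainState C n) :=
  if α = 0 then
    ((List.finRange (n + 1)).map fun l =>
      if α < l then (pauliZ (r + 1, l) * pauliZ (r, l)) ^ (P α l).val else 1).prod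
      * pauliX (r + 1, α)
  else if α = Fin.last n then
    pauliX (r, α)
      * ((List.finRange (n + 1)).map fun k =>
        if k < α then (pauliZ (r + 1, k) * pauliZ (r, k)) ^ (P k α).val else 1).prod
  else
    ((List.finRange (n + 1)).map fun l =>
      if α < l then (pauliZ (r + 1, l) * pauliZ (r, l)) ^ (P α l).val else 1).prod
      * pauliX (r + 1, α)
      * ((List.finRange (n + 1)).map fun k =>
        if k < α then (pauliZ (r + 2, k) * pauliZ (r + 1, k)) ^ (P k α).val else 1).prod

/-- The cocycle Hamiltonian `H = - ∑_r ∑_α O^r_α` on `L` unit cells, periodic boundary. -/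
def hamiltonian {n : ℕ} (P : Fin (n + 1) → Fin (n + 1) → ZMod 2) (L : ℕ) [NeZero L] :
    Module.End ℂ (ChainState (ZMod L) n) :=
  - ∑ r : ZMod L, ∑ α : Fin (n + 1), stabilizer P (ZMod L) r α

/-- `ψ` is a (nonzero) eigenvector of `H` for its lowest eigenvalue. -/
def IsGroundState {V : Type*} [AddCommGroup V] [Module ℂ V] (H : Module.End ℂ V) (ψ : V) : Prop :=
  ∃ E : ℝ, H.HasEigenvector (E : ℂ) ψ ∧ ∀ E' : ℝ, H.HasEigenvalue (E' : ℂ) → E ≤ E'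

/-! ### Matrix product states -/

/-- One matrix `T^{g_1 … g_q}` for every configuration of a unit cell; `D` is the bond
dimension. -/
abbrev MPSTensor (n D : ℕ) : Type := (Fin (n + 1) → ZMod 2) → Matrix (Fin D) (Fin D) ℂ

/-- The translation invariant MPS `∑_g Tr(T^{g^0} T^{g^1} ⋯ T^{g^{L-1}}) |g⟩`. -/
def mpsState {n D : ℕ} (T : MPSTensor n D) (L : ℕ) : ChainState (ZMod L) n := fun g =>
  ((List.ofFn fun r : Fin L => T fun i => g (((r : ℕ) : ZMod L), i)).prod).trace

/-- `T`, independent of the system size, describes a ground state of the cocycle Hamiltonian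
for all sufficiently large sizes. -/
def RepresentsGroundState {n D : ℕ} (P : Fin (n + 1) → Fin (n + 1) → ZMod 2)
    (T : MPSTensor n D) : Prop :=
  ∃ L₀ : ℕ, ∀ (L : ℕ) [NeZero L], L₀ ≤ L → IsGroundState (hamiltonian P L) (mpsState T L)

/-- `T` describes the ground state, and does so with the least possible bond dimension. -/
def IsMinimalGroundStateMPS {n D : ℕ} (P : Fin (n + 1) → Fin (n + 1) → ZMod 2)
    (T : MPSTensor n D) : Prop :=
  RepresentsGroundState P T ∧
    ∀ (D' : ℕ) (T' : MPSTensor n D'), RepresentsGroundState P T' → D ≤ D'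

/-! ### The linear equations for the MPS matrices

Every `O^r_α` is an ordered product `o^r_{α,1} o^r_{α,2} ⋯` of operators, the `τ`-th of
which acts on the cell `r + τ - 1` alone. -/

/-- The number of consecutive unit cells on which `O^r_α` acts. -/
def cellRange {n : ℕ} (α : Fin (n + 1)) : ℕ := if α = 0 ∨ α = Fin.last n then 2 else 3

/-- The factor `o_{α,τ}`, written in terms of the Pauli operators `X i`, `Z i` of the
cell on which it acts. -/
def localFactor {n : ℕ} (P : Fin (n + 1) → Fin (n + 1) → ZMod 2) {R : Type*} [Monoid R]
    (X Z : Fin (n + 1) → R) (α : Fin (n + 1)) (τ : ℕ) : R :=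
  let above := ((List.finRange (n + 1)).map fun l =>
    if α < l then Z l ^ (P α l).val else 1).prod
  let below := ((List.finRange (n + 1)).map fun k =>
    if k < α then Z k ^ (P k α).val else 1).prod
  if α = 0 then
    (if τ = 1 then above else if τ = 2 then above * X α else 1)
  else if α = Fin.last n then
    (if τ = 1 then X α * below else if τ = 2 then below else 1)
  else
    (if τ = 1 then above else if τ = 2 then above * X α * below
      else if τ = 3 then below else 1)

/-- `L^r_{α,τ} = o^r_{α,1} ⋯ o^r_{α,τ}` on the infinite chain. -/
def leftPart {n : ℕ} (P : Fin (n + 1) → Fin (n + 1) → ZMod 2) (r : ℤ) (α : Fin (n + 1)) (τ : ℕ) :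
    Module.End ℂ (ChainState ℤ n) :=
  ((List.range τ).map fun μ : ℕ =>
    localFactor P (fun i => pauliX (r + (μ : ℤ), i)) (fun i => pauliZ (r + (μ : ℤ), i)) α (μ + 1)).prod

/-- The pairs `(α, τ)` with `1 ≤ τ ≤ cellRange α - 1`; they label the ways to cut a
stabilizer. -/
abbrev Cut (n : ℕ) : Type := (α : Fin (n + 1)) × Fin (cellRange α - 1)

/-- The position `τ` of the cut, counted from `1`. -/
def Cut.pos {n : ℕ} (c : Cut n) : ℕ := (c.2 : ℕ) + 1

open Classical in
/-- The matrix `t` over `ℤ/2`: the entry is `0` or `1` as the operators `L^{r-τ+1}_{α,τ}` and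
`L^{r-τ'+1}_{α',τ'}`, all cut at the bond to the right of one cell (here `r = 0`), commute or
anticommute. -/
def commutationMatrix {n : ℕ} (P : Fin (n + 1) → Fin (n + 1) → ZMod 2) :
    Matrix (Cut n) (Cut n) (ZMod 2) := fun c d =>
  if Commute (leftPart P (0 - (c.pos : ℤ) + 1) c.1 c.pos) (leftPart P (0 - (d.pos : ℤ) + 1) d.1 d.pos)
    then 0 else 1

/-- The dimension `2^{rank(t)/2}` of the irreducible representation. -/
def irrepDim {n : ℕ} (P : Fin (n + 1) → Fin (n + 1) → ZMod 2) : ℕ :=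
  2 ^ ((commutationMatrix P).rank / 2)

/-- The virtual operators `U_{α,τ}` obey the commutation relations of the `L_{α,τ}`. -/
def IsVirtualAlgebra {n D : ℕ} (P : Fin (n + 1) → Fin (n + 1) → ZMod 2)
    (U : Cut n → GL (Fin D) ℂ) : Prop :=
  ∀ c d : Cut n, (U c : Matrix (Fin D) (Fin D) ℂ) * U d =
    (-1 : ℂ) ^ (commutationMatrix P c d).val • ((U d : Matrix (Fin D) (Fin D) ℂ) * U c)

/-- The action `(o_{α,τ} ∘ T)^g` of a one-cell factor on the physical indices. -/
def localAction {n D : ℕ} (P : Fin (n + 1) → Fin (n + 1) → ZMod 2) (α : Fin (n + 1)) (τ : ℕ)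
    (T : MPSTensor n D) : MPSTensor n D :=
  localFactor P (R := Module.End ℂ (MPSTensor n D)) pauliX pauliZ α τ T

/-- The linear equations for `T`. Here `o_{α,1} = L_{α,1}`, the middle factor
`o_{α,τ} = L_{α,τ-1}⁻¹ L_{α,τ} = R_{α,τ-1} R_{α,τ}⁻¹`, and the last factor is `R_{α,cellRange α - 1}`. -/
structure SolvesLinearEquations {n D : ℕ} (P : Fin (n + 1) → Fin (n + 1) → ZMod 2)
    (U : Cut n → GL (Fin D) ℂ) (T : MPSTensor n D) : Prop where
  first : ∀ c : Cut n, c.pos = 1 → ∀ g,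
    localAction P c.1 1 T g = T g * (U c : Matrix (Fin D) (Fin D) ℂ)
  middle : ∀ c d : Cut n, c.1 = d.1 → c.pos + 1 = d.pos → ∀ g,
    localAction P d.1 d.pos T g =
      ((U c)⁻¹ : GL (Fin D) ℂ).val * T g * (U d : Matrix (Fin D) (Fin D) ℂ)
  last : ∀ c : Cut n, c.pos + 1 = cellRange c.1 → ∀ g,
    localAction P c.1 (cellRange c.1) T g = ((U c)⁻¹ : GL (Fin D) ℂ).val * T g

end

end CocycleMPS

/-!
Up to a choice of basis every operator of the model is a signed translation of the configurations
`g : C × Fin q → ℤ/2`, and its sign is a bilinear expression in the strictly upper triangular matrix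
`Q` of the parameters `P`. The stabilizers are simultaneously fixed by exactly one state, the graph
state `∑_g (-1)^{F g} |g⟩` with `F g = ∑_r g_r ⬝ Q (g_r + g_{r-1})`, so the ground states are its
nonzero multiples.

(a) The amplitude of the graph state is a product over bonds of the overlaps `W a b`,
`W a b = (-1)^{b ⬝ Q (b + a)}`. Factoring `W a b = y_a ⬝ x_b` through its rank gives the rank one
tensor `x_g y_gᵀ`, so a minimal `T` has bond dimension at most `rank W`. The words in the `x_g y_gᵀ`
span all matrices of that size, and by comparing traces so do the words in `T`. Hence
`M = T g` inherits the relation `tr (M A M B) ∝ tr (M A) tr (M B)` for all `A`, `B`, which forces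
`M A M ∝ M` and thus rank at most one.

(b) A left part `L_{α,τ}` either is diagonal or flips spin `α` of the last cell, and left parts of
the same kind commute; so `t` has off-diagonal blocks `b`, `bᵀ` and `rank t ≤ 2 rank b`. The
equations with `τ = 1` say that the rows of `T g` are joint eigenvectors of the `U_{α,1}` that
belong to the diagonal left parts. Products of the remaining `U_{α,τ}` carry this joint eigenspace
injectively to `2 ^ rank b ≥ D` different ones, so it is at most one-dimensional.
-/

namespace CocycleMPS

section LinearAlgebra

open Matrix Module

variable {K m n : Type*} [Field K]

lemma rank_add_le [Finite m] [Fintype n] (A B : Matrix m n K) :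
    (A + B).rank ≤ A.rank + B.rank := by
  have hrange : (A + B).mulVecLin.range ≤ A.mulVecLin.range ⊔ B.mulVecLin.range := by
    rw [mulVecLin_add]
    exact LinearMap.range_add_le _ _
  exact (Submodule.finrank_mono hrange).trans (Submodule.finrank_add_le_finrank_add_finrank _ _)

lemma rank_fromBlocks_zero_zero_le {m' n' : Type*} [Finite m] [Fintype n] [Finite m']
    [Fintype n'] (B : Matrix m n' K) (C : Matrix m' n K) :
    (fromBlocks 0 B C 0).rank ≤ B.rank + C.rank := by
  classical
  have := Fintype.ofFinite m
  have := Fintype.ofFinite m'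
  have hsum : fromBlocks 0 B C 0 =
      (fromRows 1 0 : Matrix (m ⊕ m') m K) * (B * (fromCols 0 1 : Matrix n' (n ⊕ n') K)) +
        (fromRows 0 1 : Matrix (m ⊕ m') m' K) * (C * (fromCols 1 0 : Matrix n (n ⊕ n') K)) := by
    ext (i | i) (j | j) <;> simp [fromRows_mul, mul_fromCols]
  rw [hsum]
  exact (rank_add_le _ _).trans (add_le_add ((rank_mul_le_right _ _).trans (rank_mul_le_left _ _))
    ((rank_mul_le_right _ _).trans (rank_mul_le_left _ _)))

lemma rank_le_two_mul_rank_toBlock [Fintype n] {t : Matrix n n K} (ht : t.IsSymm)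
    (p : n → Prop) [DecidablePred p] (hp : t.toBlock p p = 0)
    (hnp : t.toBlock (¬ p ·) (¬ p ·) = 0) : t.rank ≤ 2 * (t.toBlock p (¬ p ·)).rank := by
  have hC : t.toBlock (¬ p ·) p = (t.toBlock p (¬ p ·))ᵀ := by
    ext i j
    exact ht.apply _ _
  calc
    t.rank = (t.reindex (Equiv.sumCompl p).symm (Equiv.sumCompl p).symm).rank :=
      (rank_reindex _ _ _).symm
    _ = (fromBlocks 0 (t.toBlock p (¬ p ·)) (t.toBlock p (¬ p ·))ᵀ 0).rank := by
      rw [← hC, ← hp, ← hnp]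
      exact congrArg rank
        (fromBlocks_toBlocks (t.submatrix (Equiv.sumCompl p) (Equiv.sumCompl p))).symm
    _ ≤ 2 * (t.toBlock p (¬ p ·)).rank := by
      rw [two_mul]
      exact (rank_fromBlocks_zero_zero_le _ _).trans_eq (by rw [rank_transpose])

lemma exists_rank_factorization [Finite m] [Fintype n] (W : Matrix m n K) :
    ∃ (y : m → Fin W.rank → K) (x : n → Fin W.rank → K), (∀ a b, y a ⬝ᵥ x b = W a b) ∧
      Submodule.span K (Set.range y) = ⊤ ∧ Submodule.span K (Set.range x) = ⊤ := by
  let e : Basis (Fin W.rank) K W.mulVecLin.range := finBasis K _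
  have hcol (b : n) : W.col b ∈ W.mulVecLin.range := by
    rw [range_mulVecLin]
    exact Submodule.subset_span (Set.mem_range_self b)
  let Y : Matrix m (Fin W.rank) K := .of fun a i => (e i).1 a
  let X : Matrix (Fin W.rank) n K := .of fun i b => e.repr ⟨W.col b, hcol b⟩ i
  have hYX : Y * X = W := by
    ext a b
    have hsum := congrFun (congrArg Subtype.val (e.sum_repr ⟨W.col b, hcol b⟩)) a
    simp only [Submodule.coe_sum, Submodule.coe_smul, Finset.sum_apply, Pi.smul_apply,
      smul_eq_mul] at hsum
    simpa only [mul_apply, Y, X, of_apply, mul_comm, col_apply] using hsum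
  refine ⟨Y.row, X.col, fun a b => congrFun (congrFun hYX a) b, ?_, ?_⟩
  · refine Submodule.eq_top_of_finrank_eq (le_antisymm (Submodule.finrank_le _) ?_)
    rw [← rank_eq_finrank_span_row, finrank_fin_fun]
    nth_rw 1 [← hYX]
    exact rank_mul_le_left _ _
  · refine Submodule.eq_top_of_finrank_eq (le_antisymm (Submodule.finrank_le _) ?_)
    rw [← rank_eq_finrank_span_cols, finrank_fin_fun]
    nth_rw 1 [← hYX]
    exact rank_mul_le_right _ _

lemma span_range_vecMulVec_eq_top {ι κ : Type*} [Finite m] [Finite n] {x : ι → m → K}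
    {y : κ → n → K} (hx : Submodule.span K (Set.range x) = ⊤)
    (hy : Submodule.span K (Set.range y) = ⊤) :
    Submodule.span K (Set.range fun p : ι × κ => vecMulVec (x p.1) (y p.2)) = ⊤ := by
  classical
  have := Fintype.ofFinite m
  have := Fintype.ofFinite n
  set V := Submodule.span K (Set.range fun p : ι × κ => vecMulVec (x p.1) (y p.2))
  have hmem (v : m → K) (w : n → K) : vecMulVec v w ∈ V := by
    have hmap := Submodule.apply_mem_map₂ (vecMulVecBilin K K)
      (hx ▸ Submodule.mem_top : v ∈ Submodule.span K (Set.range x))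
      (hy ▸ Submodule.mem_top : w ∈ Submodule.span K (Set.range y))
    rwa [Submodule.map₂_span_span, Set.image2_range] at hmap
  refine eq_top_iff.2 fun A _ => ?_
  rw [matrix_eq_sum_single A]
  refine V.sum_mem fun i _ => V.sum_mem fun j _ => ?_
  rw [← mul_one (A i j), ← smul_eq_mul, ← smul_single, single_eq_single_vecMulVec_single]
  exact V.smul_mem _ (hmem _ _)

lemma rank_le_one_of_forall_mul_mul_eq_smul [Fintype m] [Fintype n] {M : Matrix m n K}
    (h : ∀ A : Matrix n m K, ∃ c : K, M * A * M = c • M) : M.rank ≤ 1 := by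
  classical
  by_contra! hM
  obtain ⟨i, j, hij⟩ : ∃ i j, M i j ≠ 0 := by
    by_contra! hzero
    simp [show M = 0 from Matrix.ext hzero] at hM
  obtain ⟨c, hc⟩ := h (vecMulVec (Pi.single j 1) (Pi.single i 1))
  rw [mul_vecMulVec, vecMulVec_mul] at hc
  have hc0 : c ≠ 0 := by
    rintro rfl
    simpa [vecMulVec_apply, hij] using congrFun (congrFun hc i) j
  rw [← inv_smul_eq_iff₀ hc0, ← smul_vecMulVec] at hc
  exact hM.not_ge (hc ▸ rank_vecMulVec_le _ _)

lemma rank_eq_one_of_le_one_of_ne_zero [Finite m] [Fintype n] {M : Matrix m n K} (hM : M.rank ≤ 1)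
    (h0 : M ≠ 0) : M.rank = 1 := by
  classical
  refine le_antisymm hM (Nat.one_le_iff_ne_zero.2 fun hrank => h0 ?_)
  rw [Matrix.rank, Submodule.finrank_eq_zero, LinearMap.range_eq_bot] at hrank
  ext i j
  simpa using congrFun (LinearMap.congr_fun hrank (Pi.single j 1)) i

lemma sum_finrank_le_of_iSupIndep {V ι : Type*} [AddCommGroup V] [Module K V]
    [FiniteDimensional K V] [Fintype ι] {E : ι → Submodule K V} (hE : iSupIndep E) :
    ∑ i, finrank K (E i) ≤ finrank K V := by
  classical
  rw [← finrank_directSum]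
  exact LinearMap.finrank_le_finrank_of_injective hE.dfinsupp_lsum_injective

end LinearAlgebra

section TraceComparison

open Matrix Module

variable {K m m' ι κ : Type*} [Field K] [Fintype m] [Fintype m']

lemma linearIndependent_of_trace_mul_eq {t : ι → Matrix m m K} {s : ι → Matrix m' m' K} {c : K}
    (hc : c ≠ 0) (hts : ∀ i j, trace (t i * t j) = c * trace (s i * s j))
    (hs : Submodule.span K (Set.range s) = ⊤) {f : κ → ι} (hf : LinearIndependent K (s ∘ f)) :
    LinearIndependent K (t ∘ f) := by
  classical
  rw [linearIndependent_iff] at hf ⊢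
  intro l hl
  refine hf l (ext_iff_trace_mul_right.2 fun A => ?_)
  have htrace (j : ι) : trace (Finsupp.linearCombination K (t ∘ f) l * t j) =
      c * trace (Finsupp.linearCombination K (s ∘ f) l * s j) := by
    simp only [Finsupp.linearCombination_apply, Finsupp.sum, Finset.sum_mul, trace_sum,
      smul_mul_assoc, trace_smul, Function.comp_apply, hts, Finset.mul_sum, smul_eq_mul,
      mul_left_comm c]
  have hzero : traceLinearMap m' K K ∘ₗ
      LinearMap.mulLeft K (Finsupp.linearCombination K (s ∘ f) l) = 0 := by
    refine LinearMap.ext_on_range hs fun j => ?_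
    have hj := htrace j
    rw [hl, zero_mul, trace_zero] at hj
    exact (mul_eq_zero.1 hj.symm).resolve_left hc
  rw [zero_mul, trace_zero]
  exact LinearMap.congr_fun hzero A

lemma span_range_eq_top_of_trace_mul_eq {t : ι → Matrix m m K} {s : ι → Matrix m' m' K} {c : K}
    (hc : c ≠ 0) (hts : ∀ i j, trace (t i * t j) = c * trace (s i * s j))
    (hs : Submodule.span K (Set.range s) = ⊤) (hcard : Fintype.card m ≤ Fintype.card m') :
    Submodule.span K (Set.range t) = ⊤ := by
  obtain ⟨κ, f, -, hspan, hindep⟩ := exists_linearIndependent' K s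
  have htf := linearIndependent_of_trace_mul_eq hc hts hs hindep
  have := hindep.finite
  have := Fintype.ofFinite κ
  have hκ : Fintype.card κ = Fintype.card m' * Fintype.card m' := by
    rw [← finrank_eq_card_basis (Basis.mk hindep (hspan.trans hs).ge), finrank_matrix,
      finrank_self, mul_one]
  have hdim : finrank K (Matrix m m K) ≤ finrank K (Submodule.span K (Set.range (t ∘ f))) := by
    rw [finrank_span_eq_card htf, hκ, finrank_matrix, finrank_self, mul_one]
    exact Nat.mul_le_mul hcard hcard
  have hle : Submodule.span K (Set.range (t ∘ f)) ≤ Submodule.span K (Set.range t) :=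
    Submodule.span_mono (Set.range_comp_subset_range f t)
  exact eq_top_iff.2 ((Submodule.eq_top_of_finrank_eq
    (le_antisymm (Submodule.finrank_le _) hdim)).ge.trans hle)

lemma rank_le_one_of_trace_mul_mul_mul_eq {t : ι → Matrix m m K}
    (ht : Submodule.span K (Set.range t) = ⊤) {M : Matrix m m K} {k : K}
    (h : ∀ i j, trace (M * t i * M * t j) = k * (trace (M * t i) * trace (M * t j))) :
    M.rank ≤ 1 := by
  classical
  let τ := traceLinearMap m K K ∘ₗ LinearMap.mulLeft K M
  have hτ : (LinearMap.mul K (Matrix m m K)).compr₂ τ ∘ₗ LinearMap.mulRight K M =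
      k • (LinearMap.mul K K).compl₁₂ τ τ := by
    refine LinearMap.ext_on_range ht fun i => LinearMap.ext_on_range ht fun j => ?_
    simpa [τ, mul_assoc] using h i j
  refine rank_le_one_of_forall_mul_mul_eq_smul fun A =>
    ⟨k * trace (M * A), ext_iff_trace_mul_right.2 fun B => ?_⟩
  simpa [τ, mul_assoc] using LinearMap.congr_fun₂ hτ A B

lemma trace_vecMulVec_mul_mul_vecMulVec_mul (x y : m → K) (A B : Matrix m m K) :
    trace (vecMulVec x y * A * vecMulVec x y * B) =
      trace (vecMulVec x y * A) * trace (vecMulVec x y * B) := by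
  rw [mul_assoc, vecMulVec_mul x y A, vecMulVec_mul x y B, vecMulVec_mul_vecMulVec, trace_vecMulVec,
    dotProduct_smul, smul_eq_mul, trace_vecMulVec, trace_vecMulVec, dotProduct_comm (y ᵥ* A)]

section Words

variable [DecidableEq m] [DecidableEq m'] {x y : κ → m → K}

lemma exists_prod_cons_concat_vecMulVec_eq_smul (hne : ∀ a b, y a ⬝ᵥ x b ≠ 0) (a b : κ)
    (u : List κ) : ∃ c : K, c ≠ 0 ∧
      ((a :: u ++ [b]).map fun g => vecMulVec (x g) (y g)).prod = c • vecMulVec (x a) (y b) := by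
  induction u generalizing a with
  | nil => exact ⟨y a ⬝ᵥ x b, hne a b, by simp [vecMulVec_mul_vecMulVec]⟩
  | cons a' u ih =>
    obtain ⟨c, hc, h⟩ := ih a'
    refine ⟨c * (y a ⬝ᵥ x a'), mul_ne_zero hc (hne a a'), ?_⟩
    rw [List.cons_append, List.map_cons, List.prod_cons, h, mul_smul_comm,
      vecMulVec_mul_vecMulVec, vecMulVec_smul, smul_smul]

lemma span_range_prod_vecMulVec_eq_top (hx : Submodule.span K (Set.range x) = ⊤)
    (hy : Submodule.span K (Set.range y) = ⊤) (hne : ∀ a b, y a ⬝ᵥ x b ≠ 0) {N : ℕ}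
    (hN : 2 ≤ N) :
    Submodule.span K (Set.range fun u : {u : List κ // u.length = N} =>
      (u.1.map fun g => vecMulVec (x g) (y g)).prod) = ⊤ := by
  rw [eq_top_iff, ← span_range_vecMulVec_eq_top hx hy, Submodule.span_le]
  rintro _ ⟨⟨a, b⟩, rfl⟩
  obtain ⟨c, hc, h⟩ := exists_prod_cons_concat_vecMulVec_eq_smul hne a b
    (List.replicate (N - 2) a)
  have hlen : (a :: List.replicate (N - 2) a ++ [b]).length = N := by simp; lia
  refine (Submodule.smul_mem_iff _ hc).1 (h ▸ Submodule.subset_span ⟨⟨_, hlen⟩, rfl⟩)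

lemma rank_le_one_of_trace_prod_eq {T : κ → Matrix m' m' K}
    (hcard : Fintype.card m' ≤ Fintype.card m) (hx : Submodule.span K (Set.range x) = ⊤)
    (hy : Submodule.span K (Set.range y) = ⊤) (hne : ∀ a b, y a ⬝ᵥ x b ≠ 0)
    (hT : ∃ L₀ : ℕ, ∀ L ≥ L₀, ∃ c : K, c ≠ 0 ∧ ∀ u : List κ, u.length = L →
      trace (u.map T).prod = c * trace (u.map fun g => vecMulVec (x g) (y g)).prod) (g : κ) :
    (T g).rank ≤ 1 := by
  obtain ⟨L₀, hL₀⟩ := hT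
  obtain ⟨N, hN, hN₀⟩ : ∃ N, 2 ≤ N ∧ L₀ ≤ N := ⟨L₀ + 2, by lia, by lia⟩
  obtain ⟨c₂, hc₂, h₂⟩ := hL₀ (N + N) (by lia)
  obtain ⟨c₁, hc₁, h₁⟩ := hL₀ (N + 1) (by lia)
  obtain ⟨c, -, h⟩ := hL₀ (N + 1 + (N + 1)) (by lia)
  let I := {u : List κ // u.length = N}
  have hspan : Submodule.span K (Set.range fun u : I => (u.1.map T).prod) = ⊤ := by
    refine span_range_eq_top_of_trace_mul_eq hc₂ (fun u v => ?_)
      (span_range_prod_vecMulVec_eq_top hx hy hne hN) hcard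
    simpa only [List.map_append, List.prod_append] using
      h₂ (u.1 ++ v.1) (by rw [List.length_append, u.2, v.2])
  have hone (u : I) : trace (T g * (u.1.map T).prod) =
      c₁ * trace (vecMulVec (x g) (y g) * (u.1.map fun g => vecMulVec (x g) (y g)).prod) := by
    simpa only [List.map_cons, List.prod_cons] using
      h₁ (g :: u.1) (by rw [List.length_cons, u.2])
  refine rank_le_one_of_trace_mul_mul_mul_eq hspan (k := c / c₁ ^ 2) fun u v => ?_
  have htwo := h (g :: u.1 ++ g :: v.1)
    (by simp only [List.length_append, List.length_cons, u.2, v.2])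
  simp only [List.map_append, List.map_cons, List.prod_append, List.prod_cons, ← mul_assoc]
    at htwo
  rw [htwo, trace_vecMulVec_mul_mul_vecMulVec_mul, hone, hone]
  field_simp

end Words

end TraceComparison

section JointEigenspaces

open Matrix Module
open Module.End

variable {K I J : Type*} [Field K] {p : ℕ}

lemma exists_isUnit_mul_eq_of_mem_range {R : Type*} [NeZero p] [Fintype J] [Ring R] [Algebra K R]
    {χ : AddChar (ZMod p) K} {A : I → R} {B : J → R} {b : Matrix I J (ZMod p)}
    (hB : ∀ j, IsUnit (B j)) (hAB : ∀ i j, A i * B j = χ (b i j) • (B j * A i))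
    {v : I → ZMod p} (hv : v ∈ b.mulVecLin.range) :
    ∃ V : R, IsUnit V ∧ ∀ i, A i * V = χ (v i) • (V * A i) := by
  rw [range_mulVecLin] at hv
  induction hv using Submodule.span_induction with
  | mem v hv =>
    obtain ⟨j, rfl⟩ := hv
    exact ⟨B j, hB j, fun i => hAB i j⟩
  | zero => exact ⟨1, isUnit_one, fun i => by simp⟩
  | add v w _ _ ihv ihw =>
    obtain ⟨V, hV, hAV⟩ := ihv
    obtain ⟨W, hW, hAW⟩ := ihw
    refine ⟨V * W, hV.mul hW, fun i => ?_⟩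
    rw [← mul_assoc, hAV, smul_mul_assoc, mul_assoc, hAW, mul_smul_comm, smul_smul, ← mul_assoc,
      Pi.add_apply, AddChar.map_add_eq_mul]
  | smul a v _ ih =>
    obtain ⟨V, hV, hAV⟩ := ih
    refine ⟨V ^ a.val, hV.pow _, fun i => ?_⟩
    have hpow (k : ℕ) : A i * V ^ k = χ (v i) ^ k • (V ^ k * A i) := by
      induction k with
      | zero => simp
      | succ k ih =>
        rw [pow_succ, ← mul_assoc, ih, smul_mul_assoc, mul_assoc, hAV, mul_smul_comm, smul_smul,
          ← pow_succ, ← mul_assoc]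
    rw [hpow, ← AddChar.map_nsmul_eq_pow, Pi.smul_apply, nsmul_eq_mul, ZMod.natCast_zmod_val,
      smul_eq_mul]

lemma iSupIndep_iInf_eigenspace {V : Type*} [AddCommGroup V] [Module K V] {A : I → End K V}
    (hA : ∀ i j, Commute (A i) (A j)) :
    iSupIndep fun μ : I → K => ⨅ i, (A i).eigenspace (μ i) :=
  (independent_iInf_maxGenEigenspace_of_forall_mapsTo A fun i j φ =>
    mapsTo_maxGenEigenspace_of_comm (hA j i) φ).mono fun _ =>
      iInf_mono fun i => (A i).genEigenspace_le_maximal _ 1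

theorem pow_rank_mul_finrank_le {V : Type*} [AddCommGroup V] [Module K V] [FiniteDimensional K V]
    [Fact p.Prime] [Finite I] [Fintype J] {χ : AddChar (ZMod p) K} (hχ : Function.Injective χ)
    {A : I → End K V} {B : J → End K V} {b : Matrix I J (ZMod p)}
    (hA : ∀ i j, Commute (A i) (A j)) (hB : ∀ j, IsUnit (B j))
    (hAB : ∀ i j, A i * B j = χ (b i j) • (B j * A i)) {μ : I → K} (hμ : ∀ i, μ i ≠ 0)
    {W : Submodule K V} (hW : ∀ i, W ≤ (A i).eigenspace (μ i)) :
    p ^ b.rank * finrank K W ≤ finrank K V := by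
  have hshift (v : b.mulVecLin.range) : finrank K W ≤
      finrank K ↥(⨅ i, (A i).eigenspace (χ (v.1 i) * μ i)) := by
    obtain ⟨S, hS, hAS⟩ := exists_isUnit_mul_eq_of_mem_range hB hAB v.2
    have hS_inj : Function.Injective S := (End.isUnit_iff S).1 hS |>.injective
    rw [(Submodule.equivMapOfInjective S hS_inj W).finrank_eq]
    refine Submodule.finrank_mono (Submodule.map_le_iff_le_comap.2 fun w hw => ?_)
    refine Submodule.mem_comap.2 ((Submodule.mem_iInf _).2 fun i => mem_eigenspace_iff.2 ?_)
    have hi := LinearMap.congr_fun (hAS i) w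
    rw [End.mul_apply, LinearMap.smul_apply, End.mul_apply, mem_eigenspace_iff.1 (hW i hw)] at hi
    rw [hi, map_smul, smul_smul]
  have hinj : Function.Injective fun (v : b.mulVecLin.range) i => χ (v.1 i) * μ i :=
    fun v w hvw => Subtype.ext (funext fun i => hχ (mul_right_cancel₀ (hμ i) (congrFun hvw i)))
  have := Fintype.ofFinite b.mulVecLin.range
  calc
    p ^ b.rank * finrank K W = ∑ _ : b.mulVecLin.range, finrank K W := by
      rw [Finset.sum_const, smul_eq_mul, Finset.card_univ, ← Nat.card_eq_fintype_card,
        natCard_eq_pow_finrank (K := ZMod p), Nat.card_zmod, Matrix.rank]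
    _ ≤ ∑ v : b.mulVecLin.range, finrank K ↥(⨅ i, (A i).eigenspace (χ (v.1 i) * μ i)) :=
      Finset.sum_le_sum fun v _ => hshift v
    _ ≤ finrank K V := sum_finrank_le_of_iSupIndep ((iSupIndep_iInf_eigenspace hA).comp hinj)

theorem pow_rank_mul_rank_le {m : Type*} [Fintype m] [DecidableEq m] [Fact p.Prime] [Finite I]
    [Fintype J] {χ : AddChar (ZMod p) K} (hχ : Function.Injective χ) {A : I → Matrix m m K}
    {B : J → Matrix m m K} {b : Matrix I J (ZMod p)} (hA : ∀ i j, Commute (A i) (A j))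
    (hB : ∀ j, IsUnit (B j)) (hAB : ∀ i j, B j * A i = χ (b i j) • (A i * B j)) {μ : I → K}
    (hμ : ∀ i, μ i ≠ 0) {M : Matrix m m K} (hM : ∀ i, M * A i = μ i • M) :
    p ^ b.rank * M.rank ≤ Fintype.card m := by
  let φ (N : Matrix m m K) : End K (m → K) := toLinAlgEquiv' Nᵀ
  have hφ (N N' : Matrix m m K) : φ N * φ N' = φ (N' * N) := by
    rw [← map_mul, ← transpose_mul]
  have hrow := pow_rank_mul_finrank_le hχ (A := fun i => φ (A i)) (B := fun j => φ (B j))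
    (b := b) (W := (φ M).range) (fun i j => ?_) (fun j => ?_) (fun i j => ?_) hμ fun i => ?_
  · rw [finrank_fintype_fun_eq_card] at hrow
    rwa [← rank_transpose M]
  · rw [Commute, SemiconjBy, hφ, hφ, hA]
  · exact ((isUnit_transpose _).2 (hB j)).map toLinAlgEquiv'
  · rw [hφ, hφ, hAB, ← map_smul, ← transpose_smul]
  · rintro _ ⟨x, rfl⟩
    rw [mem_eigenspace_iff, ← End.mul_apply, hφ, hM, ← LinearMap.smul_apply, ← map_smul,
      ← transpose_smul]

end JointEigenspaces

section SignedShift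

/-- The additive character `a ↦ (-1)^a` of `ℤ/2`; it turns products of signs into linear algebra
over `ZMod 2`. -/
noncomputable def sgn : AddChar (ZMod 2) ℂ := AddChar.zmodChar 2 (neg_one_sq : (-1 : ℂ) ^ 2 = 1)

lemma sgn_apply (a : ZMod 2) : sgn a = (-1) ^ a.val := rfl

lemma sgn_mul_self (a : ZMod 2) : sgn a * sgn a = 1 := by
  rw [← AddChar.map_add_eq_mul, CharTwo.add_self_eq_zero, AddChar.map_zero_eq_one]

lemma sgn_sum {ι : Type*} (s : Finset ι) (f : ι → ZMod 2) :
    sgn (∑ i ∈ s, f i) = ∏ i ∈ s, sgn (f i) :=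
  map_prod sgn.toMonoidHom (fun i => Multiplicative.ofAdd (f i)) s

lemma sgn_ne_zero (a : ZMod 2) : sgn a ≠ 0 := left_ne_zero_of_mul_eq_one (sgn_mul_self a)

lemma sgn_injective : Function.Injective sgn := by
  have hone : sgn 1 = -1 := by rw [sgn_apply, ZMod.val_one, pow_one]
  have hcases (a : ZMod 2) : a = 0 ∨ a = 1 := by revert a; decide
  intro a b
  rcases hcases a with rfl | rfl <;> rcases hcases b with rfl | rfl <;> norm_num [hone]

variable {G M : Type*} [AddCommGroup G] [AddCommGroup M] [Module ℂ M]

/-- The operator `f ↦ (g ↦ (-1)^{φ g} f (g + s))`. Every product of Pauli operators has this form,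
with `s` the set of flipped spins and `φ` an affine function on the configurations. -/
noncomputable def signedShift (φ : G → ZMod 2) (s : G) : Module.End ℂ (G → M) :=
  LinearMap.pi fun g => sgn (φ g) • LinearMap.proj (g + s)

lemma signedShift_apply (φ : G → ZMod 2) (s : G) (f : G → M) (g : G) :
    signedShift φ s f g = sgn (φ g) • f (g + s) := rfl

lemma signedShift_zero_zero : (signedShift 0 0 : Module.End ℂ (G → M)) = 1 := by
  ext f g
  simp [signedShift_apply]

lemma signedShift_mul (φ φ' : G → ZMod 2) (s s' : G) :
    (signedShift φ s * signedShift φ' s' : Module.End ℂ (G → M)) =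
      signedShift (fun g => φ g + φ' (g + s)) (s + s') := by
  ext f g
  simp only [Module.End.mul_apply, signedShift_apply, smul_smul, AddChar.map_add_eq_mul, add_assoc]

lemma signedShift_commute {φ φ' : G → ZMod 2} {s s' : G}
    (h : ∀ g, φ g + φ' (g + s) = φ' g + φ (g + s')) :
    Commute (signedShift φ s : Module.End ℂ (G → M)) (signedShift φ' s') := by
  rw [Commute, SemiconjBy, signedShift_mul, signedShift_mul, funext h, add_comm s]

lemma signedShift_zero_pow (φ : G → ZMod 2) (k : ℕ) :
    (signedShift φ 0 : Module.End ℂ (G → M)) ^ k = signedShift (k • φ) 0 := by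
  induction k with
  | zero => rw [pow_zero, zero_smul, signedShift_zero_zero]
  | succ k ih =>
    rw [pow_succ, ih, signedShift_mul, add_zero, succ_nsmul]
    simp only [add_zero]
    rfl

lemma prod_map_signedShift_zero {κ : Type*} (l : List κ) (φ : κ → G → ZMod 2) :
    (l.map fun i => (signedShift (φ i) 0 : Module.End ℂ (G → M))).prod =
      signedShift (l.map φ).sum 0 := by
  induction l with
  | nil => exact signedShift_zero_zero.symm
  | cons i l ih =>
    rw [List.map_cons, List.prod_cons, ih, signedShift_mul, List.map_cons, List.sum_cons]
    simp only [add_zero]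
    rfl

lemma prod_ite_signedShift_zero_pow {k : ℕ} (φ : Fin k → G → ZMod 2) (p : Fin k → ZMod 2)
    (c : Fin k → Prop) [DecidablePred c] :
    ((List.finRange k).map fun i =>
      if c i then (signedShift (φ i) 0 : Module.End ℂ (G → M)) ^ (p i).val else 1).prod =
      signedShift (fun g => ∑ i, (if c i then p i else 0) * φ i g) 0 := by
  have hfactor (i : Fin k) :
      (if c i then (signedShift (φ i) 0 : Module.End ℂ (G → M)) ^ (p i).val else 1) =
        signedShift (fun g => (if c i then p i else 0) * φ i g) 0 := by
    split_ifs
    · rw [signedShift_zero_pow]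
      congr 1
      ext g
      rw [Pi.smul_apply, nsmul_eq_mul, ZMod.natCast_zmod_val]
    · simp only [zero_mul]
      exact signedShift_zero_zero.symm
  simp only [hfactor]
  rw [prod_map_signedShift_zero, ← Fin.sum_univ_def]
  congr 1
  ext g
  exact Finset.sum_apply _ _ _

variable {ι : Type*}

lemma pauliZ_eq_signedShift (i : ι) :
    (pauliZ i : Module.End ℂ ((ι → ZMod 2) → M)) = signedShift (fun g => g i) 0 := by
  ext f g
  rw [signedShift_apply, add_zero]
  rfl

lemma pauliX_eq_signedShift [DecidableEq ι] (i : ι) :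
    (pauliX i : Module.End ℂ ((ι → ZMod 2) → M)) = signedShift 0 (Pi.single i 1) := by
  ext f g
  have hflip : Function.update g i (1 - g i) = g + Pi.single i 1 := by
    rw [CharTwo.sub_eq_add, add_comm, Function.update_eq_iff]
    simp +contextual
  rw [signedShift_apply, Pi.zero_apply, AddChar.map_zero_eq_one, one_smul, ← hflip]
  rfl

end SignedShift

section Stabilizers

open Matrix

variable {n : ℕ} (P : Fin (n + 1) → Fin (n + 1) → ZMod 2)

/-- The strictly upper triangular matrix of the cocycle parameters `P i j`, `i < j`, in terms of
which all signs of the model are bilinear forms in the cell configurations. -/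
def cocycleMatrix : Matrix (Fin (n + 1)) (Fin (n + 1)) (ZMod 2) :=
  .of fun i j => if i < j then P i j else 0

lemma cocycleMatrix_apply_self (α : Fin (n + 1)) : cocycleMatrix P α α = 0 := if_neg (lt_irrefl α)

lemma cocycleMatrix_mulVec_last (x : Fin (n + 1) → ZMod 2) :
    (cocycleMatrix P *ᵥ x) (Fin.last n) = 0 := by
  simp [mulVec, dotProduct, cocycleMatrix, not_lt.2 (Fin.le_last _)]

lemma vecMul_cocycleMatrix_zero (x : Fin (n + 1) → ZMod 2) : (x ᵥ* cocycleMatrix P) 0 = 0 := by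
  simp [vecMul, dotProduct, cocycleMatrix]

lemma vecMul_cocycleMatrix_congr {x y : Fin (n + 1) → ZMod 2} {α : Fin (n + 1)}
    (h : ∀ k < α, x k = y k) : (x ᵥ* cocycleMatrix P) α = (y ᵥ* cocycleMatrix P) α := by
  simp only [vecMul, dotProduct]
  refine Finset.sum_congr rfl fun k _ => ?_
  by_cases hk : k < α
  · rw [h k hk]
  · simp [cocycleMatrix, hk]

variable {ι M : Type*} [AddCommGroup M] [Module ℂ M]

lemma prod_above_signedShift_pow (φ : Fin (n + 1) → (ι → ZMod 2) → ZMod 2) (α : Fin (n + 1)) :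
    ((List.finRange (n + 1)).map fun l => if α < l then
      (signedShift (φ l) 0 : Module.End ℂ ((ι → ZMod 2) → M)) ^ (P α l).val else 1).prod =
      signedShift (fun g => (cocycleMatrix P *ᵥ fun l => φ l g) α) 0 :=
  prod_ite_signedShift_zero_pow φ (P α) (α < ·)

lemma prod_below_signedShift_pow (φ : Fin (n + 1) → (ι → ZMod 2) → ZMod 2) (α : Fin (n + 1)) :
    ((List.finRange (n + 1)).map fun k => if k < α then
      (signedShift (φ k) 0 : Module.End ℂ ((ι → ZMod 2) → M)) ^ (P k α).val else 1).prod =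
      signedShift (fun g => ((fun k => φ k g) ᵥ* cocycleMatrix P) α) 0 := by
  simp only [← mulVec_transpose]
  exact prod_ite_signedShift_zero_pow φ (P · α) (· < α)

variable {C : Type*} [CommRing C]

/-- The cell of the spin flipped by `O^r_α`. -/
def flippedCell (r : C) (α : Fin (n + 1)) : C := if α ≠ 0 ∧ α = Fin.last n then r else r + 1

/-- The exponent of the sign in the stabilizer that flips spin `α` of the cell `r`; the
configuration of that cell is `Function.curry g r`. -/
def stabilizerSign (r : C) (α : Fin (n + 1)) (g : C × Fin (n + 1) → ZMod 2) : ZMod 2 :=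
  (cocycleMatrix P *ᵥ (Function.curry g r + Function.curry g (r - 1))) α +
    ((Function.curry g (r + 1) + Function.curry g r) ᵥ* cocycleMatrix P) α

variable [DecidableEq C]

omit [CommRing C] in
lemma curry_add_single (g : C × Fin (n + 1) → ZMod 2) (r s : C) (α : Fin (n + 1)) :
    Function.curry (g + Pi.single (s, α) 1) r =
      Function.curry g r + Pi.single (M := fun _ => Fin (n + 1) → ZMod 2) s (Pi.single α 1) r := by
  ext i
  by_cases hr : r = s <;> by_cases hi : i = α <;> simp [hr, hi]

lemma stabilizer_eq_signedShift (r : C) (α : Fin (n + 1)) :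
    stabilizer P C r α =
      signedShift (stabilizerSign P (flippedCell r α) α) (Pi.single (flippedCell r α, α) 1) := by
  have hbelow (g : C × Fin (n + 1) → ZMod 2) (s t : C) :
      ((fun k => (g + Pi.single (s, α) 1 : C × Fin (n + 1) → ZMod 2) (t + 1, k) +
        (g + Pi.single (s, α) 1 : C × Fin (n + 1) → ZMod 2) (t, k)) ᵥ* cocycleMatrix P) α =
        ((Function.curry g (t + 1) + Function.curry g t) ᵥ* cocycleMatrix P) α :=
    vecMul_cocycleMatrix_congr P fun k hk => by simp [hk.ne]
  simp only [stabilizer, pauliZ_eq_signedShift, pauliX_eq_signedShift, signedShift_mul, add_zero,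
    prod_above_signedShift_pow, prod_below_signedShift_pow, zero_add, Pi.zero_apply, flippedCell]
  rcases eq_or_ne α 0 with rfl | h0
  · rw [if_pos rfl, if_neg (by simp)]
    congr 1
    ext g
    rw [stabilizerSign, vecMul_cocycleMatrix_zero, add_zero, add_sub_cancel_right]
    rfl
  rcases eq_or_ne α (Fin.last n) with rfl | hlast
  · rw [if_neg h0, if_pos rfl, if_pos ⟨h0, rfl⟩]
    congr 1
    ext g
    rw [stabilizerSign, cocycleMatrix_mulVec_last, zero_add, hbelow]
  · rw [if_neg h0, if_neg hlast, if_neg (by simp [hlast])]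
    congr 1
    ext g
    rw [stabilizerSign, add_sub_cancel_right, ← hbelow g (r + 1)]
    simp only [add_assoc, one_add_one_eq_two]
    rfl

end Stabilizers

section FrustrationFree

variable {𝕜 F I : Type*} [RCLike 𝕜] [NormedAddCommGroup F] [InnerProductSpace 𝕜 F] [Fintype I]

lemma eq_of_sum_eq_smul_of_norm_le {v : I → F} {u : F} {c : ℝ} (hc : Fintype.card I ≤ c)
    (hnorm : ∀ i, ‖v i‖ ≤ ‖u‖) (hsum : ∑ i, v i = (c : 𝕜) • u) (i : I) : v i = u := by
  have hinner : ∑ i, RCLike.re (inner 𝕜 (v i) u) = c * ‖u‖ ^ 2 := by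
    rw [← map_sum, ← sum_inner, hsum, inner_smul_left, RCLike.conj_ofReal, RCLike.re_ofReal_mul,
      inner_self_eq_norm_sq]
  have hdist : ∑ i, ‖v i - u‖ ^ 2 ≤ 0 := calc
    ∑ i, ‖v i - u‖ ^ 2 = ∑ i, ‖v i‖ ^ 2 - 2 * (c * ‖u‖ ^ 2) + Fintype.card I * ‖u‖ ^ 2 := by
      simp only [norm_sub_sq (𝕜 := 𝕜), Finset.sum_add_distrib, Finset.sum_sub_distrib,
        ← Finset.mul_sum, hinner, Finset.sum_const, Finset.card_univ, nsmul_eq_mul]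
    _ ≤ Fintype.card I * ‖u‖ ^ 2 - 2 * (c * ‖u‖ ^ 2) + Fintype.card I * ‖u‖ ^ 2 := by
      gcongr
      rw [← nsmul_eq_mul, ← Finset.card_univ, ← Finset.sum_const]
      gcongr
      exact hnorm _
    _ ≤ 0 := by nlinarith [sq_nonneg ‖u‖]
  have hzero := (Finset.sum_eq_zero_iff_of_nonneg fun j _ => sq_nonneg ‖v j - u‖).1
    (hdist.antisymm (Finset.sum_nonneg fun i _ => sq_nonneg _)) i (Finset.mem_univ i)
  exact sub_eq_zero.1 (norm_eq_zero.1 (pow_eq_zero_iff two_ne_zero |>.1 hzero))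

variable {V H : Type*} [AddCommGroup V] [Module ℂ V] [NormedAddCommGroup H]
  [InnerProductSpace ℂ H]

theorem isGroundState_neg_sum_iff {e : V →ₗ[ℂ] H} (he : Function.Injective e)
    {O : I → Module.End ℂ V} (hO : ∀ i v, ‖e (O i v)‖ ≤ ‖e v‖) {φ : V} (hφ : φ ≠ 0)
    (hfix : ∀ i, O i φ = φ) {ψ : V} :
    IsGroundState (-∑ i, O i) ψ ↔ ψ ≠ 0 ∧ ∀ i, O i ψ = ψ := by
  have hsum (v : V) (E : ℝ) : (-∑ i, O i) v = (E : ℂ) • v ↔ ∑ i, O i v = ((-E : ℝ) : ℂ) • v := by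
    rw [LinearMap.neg_apply, LinearMap.sum_apply, neg_eq_iff_eq_neg, Complex.ofReal_neg, neg_smul]
  have hfixed {v : V} (hv : ∀ i, O i v = v) :
      (-∑ i, O i) v = ((-(Fintype.card I : ℝ) : ℝ) : ℂ) • v := by
    simp [hv, Nat.cast_smul_eq_nsmul]
  constructor
  · rintro ⟨E, hE, hmin⟩
    have hcard := hmin _ (Module.End.hasEigenvalue_of_hasEigenvector
      ⟨Module.End.mem_eigenspace_iff.2 (hfixed hfix), hφ⟩)
    refine ⟨hE.2, fun i => he (eq_of_sum_eq_smul_of_norm_le (𝕜 := ℂ) (c := -E) (by linarith)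
      (fun i => hO i ψ) ?_ i)⟩
    rw [← map_sum, (hsum ψ E).1 hE.apply_eq_smul, map_smul]
    rfl
  · rintro ⟨hψ, hψfix⟩
    refine ⟨_, ⟨Module.End.mem_eigenspace_iff.2 (hfixed hψfix), hψ⟩, fun E hE => ?_⟩
    obtain ⟨v, hv⟩ := hE.exists_hasEigenvector
    have hbound : -E * ‖e v‖ ≤ Fintype.card I * ‖e v‖ := calc
      -E * ‖e v‖ ≤ ‖e (∑ i, O i v)‖ := by
        rw [(hsum v E).1 hv.apply_eq_smul, map_smul, norm_smul, Complex.norm_real]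
        gcongr
        exact le_abs_self _
      _ ≤ ∑ _ : I, ‖e v‖ := by
        rw [map_sum]
        exact norm_sum_le_of_le _ fun i _ => hO i v
      _ = Fintype.card I * ‖e v‖ := by rw [Finset.sum_const, Finset.card_univ, nsmul_eq_mul]
    have hpos : 0 < ‖e v‖ := norm_pos_iff.2 ((map_ne_zero_iff e he).2 hv.2)
    linarith [le_of_mul_le_mul_right hbound hpos]

end FrustrationFree

section GraphState

open Matrix

lemma norm_toLp_signedShift {G : Type*} [AddCommGroup G] [Fintype G] (φ : G → ZMod 2) (s : G)
    (f : G → ℂ) : ‖WithLp.toLp 2 (signedShift φ s f)‖ = ‖WithLp.toLp 2 f‖ := by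
  have hnorm (a : ZMod 2) : ‖sgn a‖ = 1 := by simp [sgn_apply]
  simp only [EuclideanSpace.norm_eq, signedShift_apply, norm_smul, hnorm, one_mul]
  exact congrArg Real.sqrt (Equiv.sum_comp (Equiv.addRight s) fun g => ‖f g‖ ^ 2)

lemma eq_apply_zero_of_add_single_eq {ι R : Type*} [Finite ι] [DecidableEq ι]
    {f : (ι → ZMod 2) → R} (h : ∀ g i, f (g + Pi.single i 1) = f g) (g : ι → ZMod 2) :
    f g = f 0 := by
  have htranslate : ∀ g', f (g' + g) = f g' := by
    induction g using Pi.single_induction with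
    | zero => simp
    | add s t hs ht => exact fun g' => by rw [← add_assoc, ht, hs]
    | single i a =>
      obtain rfl | rfl : a = 0 ∨ a = 1 := by revert a; decide
      · simp
      · exact fun g' => h g' i
  simpa using htranslate 0

lemma sum_add_dotProduct_mulVec_add {C m R : Type*} [CommRing C] [Fintype C] [Fintype m]
    [CommRing R] (Q : Matrix m m R) (x d : C → m → R) :
    ∑ r, (x r + d r) ⬝ᵥ Q *ᵥ (x r + d r + (x (r - 1) + d (r - 1))) =
      ∑ r, x r ⬝ᵥ Q *ᵥ (x r + x (r - 1)) +
        ∑ r, d r ⬝ᵥ (Q *ᵥ (x r + x (r - 1)) + (x (r + 1) + x r) ᵥ* Q) +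
        ∑ r, d r ⬝ᵥ Q *ᵥ (d r + d (r - 1)) := by
  have hadjoint (y z : m → R) : y ⬝ᵥ Q *ᵥ z = z ⬝ᵥ (y ᵥ* Q) := by
    rw [dotProduct_mulVec, dotProduct_comm]
  have hshift : ∑ r, d (r - 1) ⬝ᵥ (x r ᵥ* Q) = ∑ r, d r ⬝ᵥ (x (r + 1) ᵥ* Q) := by
    rw [← Equiv.sum_comp (Equiv.addRight (1 : C))]
    simp only [Equiv.coe_addRight, add_sub_cancel_right]
  simp only [add_dotProduct, dotProduct_add, mulVec_add, add_vecMul, Finset.sum_add_distrib,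
    hadjoint (x _) (d _), hshift]
  ring

variable {n : ℕ} (P : Fin (n + 1) → Fin (n + 1) → ZMod 2)

/-- The quadratic form whose sign is the ground state; flipping one spin changes it by
`stabilizerSign`. -/
def graphForm {C : Type*} [CommRing C] [Fintype C] (g : C × Fin (n + 1) → ZMod 2) : ZMod 2 :=
  ∑ r : C, Function.curry g r ⬝ᵥ
    cocycleMatrix P *ᵥ (Function.curry g r + Function.curry g (r - 1))

lemma graphForm_add_single {C : Type*} [CommRing C] [Fintype C] [DecidableEq C]
    (g : C × Fin (n + 1) → ZMod 2) (s : C) (α : Fin (n + 1)) :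
    graphForm P (g + Pi.single (s, α) 1) = graphForm P g + stabilizerSign P s α g := by
  set Q := cocycleMatrix P with hQ
  set x := Function.curry g with hx
  set d : C → Fin (n + 1) → ZMod 2 := Pi.single s (Pi.single α 1) with hd
  have hsum (y : C → Fin (n + 1) → ZMod 2) : ∑ r, d r ⬝ᵥ y r = y s α := by
    rw [Finset.sum_eq_single s (fun r _ hr => by simp [hd, hr]) (by simp), hd, Pi.single_eq_same,
      single_one_dotProduct]
  have hself (r : C) : (Q *ᵥ d r) α = 0 := by
    rcases eq_or_ne r s with rfl | hr
    · simp [hd, hQ, cocycleMatrix_apply_self]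
    · simp [hd, hr]
  have hcross : ∑ r, d r ⬝ᵥ Q *ᵥ (d r + d (r - 1)) = 0 := by
    rw [hsum, mulVec_add, Pi.add_apply, hself, hself, add_zero]
  simp only [graphForm, curry_add_single, ← hx, ← hd, ← hQ]
  rw [sum_add_dotProduct_mulVec_add, hcross, hsum, add_zero]
  rfl

/-- The cluster-type state `∑_g (-1)^{graphForm g} |g⟩` stabilized by all `O^r_α`. -/
noncomputable def graphState (L : ℕ) [NeZero L] : ChainState (ZMod L) n :=
  fun g => sgn (graphForm P g)

variable (L : ℕ) [NeZero L]

lemma graphState_ne_zero : graphState P L ≠ 0 := fun h => sgn_ne_zero _ (congrFun h 0)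

lemma signedShift_stabilizerSign_eq_self_iff {ψ : ChainState (ZMod L) n} (s : ZMod L)
    (α : Fin (n + 1)) :
    signedShift (stabilizerSign P s α) (Pi.single (s, α) 1) ψ = ψ ↔
      ∀ g, graphState P L (g + Pi.single (s, α) 1) * ψ (g + Pi.single (s, α) 1) =
        graphState P L g * ψ g := by
  refine funext_iff.trans (forall_congr' fun g => ?_)
  rw [signedShift_apply, graphState, graphForm_add_single, AddChar.map_add_eq_mul, mul_assoc,
    smul_eq_mul, graphState, mul_right_inj' (sgn_ne_zero _)]

lemma stabilizer_graphState (r : ZMod L) (α : Fin (n + 1)) :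
    stabilizer P (ZMod L) r α (graphState P L) = graphState P L := by
  rw [stabilizer_eq_signedShift, signedShift_stabilizerSign_eq_self_iff]
  exact fun g => (sgn_mul_self _).trans (sgn_mul_self _).symm

lemma eq_smul_graphState_of_forall_stabilizer_eq {ψ : ChainState (ZMod L) n}
    (hψ : ∀ r α, stabilizer P (ZMod L) r α ψ = ψ) : ψ = ψ 0 • graphState P L := by
  have hflip (g : ZMod L × Fin (n + 1) → ZMod 2) (i : ZMod L × Fin (n + 1)) :
      graphState P L (g + Pi.single i 1) * ψ (g + Pi.single i 1) = graphState P L g * ψ g := by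
    obtain ⟨s, α⟩ := i
    obtain ⟨r, rfl⟩ : ∃ r, flippedCell r α = s := by
      unfold flippedCell
      split_ifs
      exacts [⟨s, rfl⟩, ⟨s - 1, sub_add_cancel s 1⟩]
    exact (signedShift_stabilizerSign_eq_self_iff P L _ α).1
      (stabilizer_eq_signedShift P r α ▸ hψ r α) g
  ext g
  have hconst := eq_apply_zero_of_add_single_eq
    (f := fun g => graphState P L g * ψ g) hflip g
  have hform : graphForm P (0 : ZMod L × Fin (n + 1) → ZMod 2) = 0 :=
    Finset.sum_eq_zero fun r _ => zero_dotProduct _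
  have hzero : graphState P L 0 = 1 := by rw [graphState, hform, AddChar.map_zero_eq_one]
  simp only [hzero, one_mul] at hconst
  rw [Pi.smul_apply, ← hconst, smul_eq_mul, mul_right_comm, graphState, sgn_mul_self, one_mul]

theorem isGroundState_hamiltonian_iff {ψ : ChainState (ZMod L) n} :
    IsGroundState (hamiltonian P L) ψ ↔ ∃ c : ℂ, c ≠ 0 ∧ ψ = c • graphState P L := by
  have hH : hamiltonian P L =
      -∑ i : ZMod L × Fin (n + 1), stabilizer P (ZMod L) i.1 i.2 := by
    rw [hamiltonian, Fintype.sum_prod_type]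
  rw [hH, isGroundState_neg_sum_iff
    (O := fun i : ZMod L × Fin (n + 1) => stabilizer P (ZMod L) i.1 i.2)
    (e := (WithLp.linearEquiv 2 ℂ _).symm.toLinearMap)
    (LinearEquiv.injective _) (fun i v => ?_) (graphState_ne_zero P L)
    fun i => stabilizer_graphState P L i.1 i.2]
  · constructor
    · rintro ⟨hψ, hfix⟩
      have hψ' := eq_smul_graphState_of_forall_stabilizer_eq P L fun r α => hfix (r, α)
      exact ⟨ψ 0, left_ne_zero_of_smul (hψ' ▸ hψ), hψ'⟩
    · rintro ⟨c, hc, rfl⟩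
      exact ⟨smul_ne_zero hc (graphState_ne_zero P L), fun i => by
        rw [map_smul, stabilizer_graphState]⟩
  · rw [stabilizer_eq_signedShift]
    exact (norm_toLp_signedShift _ _ v).le

end GraphState

section MinimalMPS

open Matrix

section RankOneWords

variable {K m : Type*} [Field K] [Fintype m] [DecidableEq m]

lemma prod_ofFn_vecMulVec {k : ℕ} (x y : Fin (k + 1) → m → K) :
    (List.ofFn fun r => vecMulVec (x r) (y r)).prod =
      (∏ r : Fin k, y r.castSucc ⬝ᵥ x r.succ) • vecMulVec (x 0) (y (Fin.last k)) := by
  induction k with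
  | zero => simp
  | succ k ih =>
    rw [List.ofFn_succ, List.prod_cons, ih (fun r => x r.succ) (fun r => y r.succ), mul_smul_comm,
      vecMulVec_mul_vecMulVec, vecMulVec_smul, smul_smul, Fin.prod_univ_succ, mul_comm]
    rfl

lemma trace_prod_ofFn_vecMulVec {k : ℕ} (x y : Fin (k + 1) → m → K) :
    trace (List.ofFn fun r => vecMulVec (x r) (y r)).prod = ∏ r, y r ⬝ᵥ x (r + 1) := by
  rw [prod_ofFn_vecMulVec, trace_smul, trace_vecMulVec, Fin.prod_univ_castSucc, smul_eq_mul,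
    dotProduct_comm (x 0), Fin.last_add_one]
  simp only [Fin.coeSucc_eq_succ]

end RankOneWords

variable {n : ℕ} {P : Fin (n + 1) → Fin (n + 1) → ZMod 2}

lemma mpsState_vecMulVec {R : ℕ} {x y : (Fin (n + 1) → ZMod 2) → Fin R → ℂ}
    (hxy : ∀ a b, y a ⬝ᵥ x b = sgn (b ⬝ᵥ cocycleMatrix P *ᵥ (b + a))) (L : ℕ) [NeZero L] :
    mpsState (fun g => vecMulVec (x g) (y g)) L = graphState P L := by
  obtain ⟨k, rfl⟩ := Nat.exists_eq_succ_of_ne_zero (NeZero.ne L)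
  ext g
  have hcell (r : Fin (k + 1)) : (((r : ℕ) : ZMod (k + 1))) = r := Fin.cast_val_eq_self r
  simp only [mpsState, hcell]
  rw [trace_prod_ofFn_vecMulVec, graphState, graphForm, sgn_sum,
    ← Equiv.prod_comp (Equiv.addRight (1 : ZMod (k + 1)))]
  have hbond (r : ZMod (k + 1)) : y (Function.curry g r) ⬝ᵥ x (Function.curry g (r + 1)) =
      sgn (Function.curry g (r + 1) ⬝ᵥ cocycleMatrix P *ᵥ
        (Function.curry g (r + 1) + Function.curry g (r + 1 - 1))) := by
    rw [hxy, add_sub_cancel_right]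
  exact Finset.prod_congr rfl fun r _ => hbond r

lemma mpsState_get {D : ℕ} (T : MPSTensor n D) (u : List (Fin (n + 1) → ZMod 2))
    [NeZero u.length] :
    mpsState T u.length (fun p => u.get ⟨p.1.val, ZMod.val_lt p.1⟩ p.2) =
      trace (u.map T).prod := by
  have hval (r : Fin u.length) : (((r : ℕ) : ZMod u.length)).val = r := ZMod.val_natCast_of_lt r.2
  simp only [mpsState, hval]
  rw [← List.ofFn_getElem_eq_map]
  rfl

theorem IsMinimalGroundStateMPS.rank_eq_one {D : ℕ} {T : MPSTensor n D}
    (hT : IsMinimalGroundStateMPS P T) {g : Fin (n + 1) → ZMod 2} (hg : T g ≠ 0) :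
    (T g).rank = 1 := by
  obtain ⟨⟨L₀, hL₀⟩, hmin⟩ := hT
  obtain ⟨y, x, hxy, hy, hx⟩ := exists_rank_factorization
    (.of fun a b : Fin (n + 1) → ZMod 2 => sgn (b ⬝ᵥ cocycleMatrix P *ᵥ (b + a)))
  have hS (L : ℕ) [NeZero L] : mpsState (fun g => vecMulVec (x g) (y g)) L = graphState P L :=
    mpsState_vecMulVec hxy L
  have hD := hmin _ (fun g => vecMulVec (x g) (y g)) ⟨0, fun L _ _ =>
    (isGroundState_hamiltonian_iff P L).2 ⟨1, one_ne_zero, by rw [hS, one_smul]⟩⟩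
  refine rank_eq_one_of_le_one_of_ne_zero (rank_le_one_of_trace_prod_eq (by simpa using hD) hx hy
    (fun a b => hxy a b ▸ sgn_ne_zero _) ⟨L₀ + 1, fun L hL => ?_⟩ g) hg
  have : NeZero L := ⟨by lia⟩
  obtain ⟨c, hc, hψ⟩ := (isGroundState_hamiltonian_iff P L).1 (hL₀ L (by lia))
  refine ⟨c, hc, fun u hu => ?_⟩
  subst hu
  rw [← mpsState_get, ← mpsState_get, hψ, hS]
  rfl

end MinimalMPS

section VirtualAlgebra

open Matrix

variable {n : ℕ}

/-- The cuts whose left part `L_{α,τ}` contains no spin flip and hence is diagonal. -/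
def Cut.IsDiagonal (c : Cut n) : Prop := c.1 = 0 ∨ c.pos + 1 ≠ cellRange c.1

lemma Cut.IsDiagonal.pos_eq_one {c : Cut n} (hc : c.IsDiagonal) : c.pos = 1 := by
  obtain ⟨α, τ, hτ⟩ := c
  simp only [Cut.IsDiagonal, Cut.pos, cellRange] at hτ hc ⊢
  split_ifs at hτ hc <;> lia

lemma Cut.IsDiagonal.eq_zero_or_ne_last {c : Cut n} (hc : c.IsDiagonal) :
    c.1 = 0 ∨ c.1 ≠ Fin.last n := by
  obtain ⟨α, τ, hτ⟩ := c
  simp only [Cut.IsDiagonal, Cut.pos, cellRange] at hτ hc ⊢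
  split_ifs at hτ hc <;> lia

variable (P : Fin (n + 1) → Fin (n + 1) → ZMod 2)

lemma localFactor_one_eq_signedShift {ι M : Type*} [DecidableEq ι] [AddCommGroup M] [Module ℂ M]
    (s : Fin (n + 1) → ι) {α : Fin (n + 1)} (hα : α = 0 ∨ α ≠ Fin.last n) :
    localFactor P (fun i => pauliX (s i)) (fun i => pauliZ (s i)) α 1 =
      (signedShift (fun g => (cocycleMatrix P *ᵥ (g ∘ s)) α) 0 :
        Module.End ℂ ((ι → ZMod 2) → M)) := by
  simp only [localFactor, pauliZ_eq_signedShift, prod_above_signedShift_pow, if_true]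
  split_ifs <;> first | rfl | tauto

lemma localAction_one_apply {D : ℕ} (T : MPSTensor n D) {α : Fin (n + 1)}
    (hα : α = 0 ∨ α ≠ Fin.last n) (g : Fin (n + 1) → ZMod 2) :
    localAction P α 1 T g = sgn ((cocycleMatrix P *ᵥ g) α) • T g := by
  have hfactor := localFactor_one_eq_signedShift P (M := Matrix (Fin D) (Fin D) ℂ) id hα
  rw [localAction]
  exact (congrFun (LinearMap.congr_fun hfactor T) g).trans (by
    rw [signedShift_apply, add_zero, Function.comp_id])

lemma leftPart_of_isDiagonal {c : Cut n} (hc : c.IsDiagonal) :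
    leftPart P (0 - c.pos + 1) c.1 c.pos =
      signedShift (fun g => (cocycleMatrix P *ᵥ Function.curry g 0) c.1) 0 := by
  have hfactor := localFactor_one_eq_signedShift P (M := ℂ) (fun i => ((0 : ℤ), i))
    hc.eq_zero_or_ne_last
  rw [hc.pos_eq_one]
  refine Eq.trans ?_ hfactor
  simp [leftPart]

lemma leftPart_of_not_isDiagonal {c : Cut n} (hc : ¬ c.IsDiagonal) :
    leftPart P (0 - c.pos + 1) c.1 c.pos =
      signedShift (fun g => (cocycleMatrix P *ᵥ (Function.curry g (-1) + Function.curry g 0)) c.1 +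
        (Function.curry g 0 ᵥ* cocycleMatrix P) c.1) (Pi.single (0, c.1) 1) := by
  have hbelow (g : ℤ × Fin (n + 1) → ZMod 2) (α : Fin (n + 1)) :
      ((fun k => g (0, k) + (Pi.single (0, α) 1 : ℤ × Fin (n + 1) → ZMod 2) (0, k)) ᵥ*
        cocycleMatrix P) α = ((fun k => g (0, k)) ᵥ* cocycleMatrix P) α :=
    vecMul_cocycleMatrix_congr P fun k hk => by simp [hk.ne]
  have hcurry (g : ℤ × Fin (n + 1) → ZMod 2) (r : ℤ) : Function.curry g r = fun k => g (r, k) := rfl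
  obtain ⟨h0, hpos⟩ := not_or.1 hc
  rw [not_not, cellRange] at hpos
  simp only [leftPart, localFactor, pauliZ_eq_signedShift, pauliX_eq_signedShift,
    prod_above_signedShift_pow, prod_below_signedShift_pow, if_neg h0]
  rcases eq_or_ne c.1 (Fin.last n) with hlast | hlast
  · have hone : c.pos = 1 := by simpa [hlast] using hpos
    simp [hone, hlast, signedShift_mul, cocycleMatrix_mulVec_last, hbelow, hcurry]
  · have htwo : c.pos = 2 := by simpa [h0, hlast] using hpos
    simp [htwo, hlast, signedShift_mul, List.range_succ, hbelow, mulVec_add, hcurry,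
      add_assoc]

lemma commutationMatrix_isSymm : (commutationMatrix P).IsSymm :=
  IsSymm.ext fun _ _ => by
    classical exact if_congr Commute.symm_iff rfl rfl

lemma commutationMatrix_of_isDiagonal {c d : Cut n} (hc : c.IsDiagonal) (hd : d.IsDiagonal) :
    commutationMatrix P c d = 0 := by
  refine if_pos ?_
  rw [leftPart_of_isDiagonal P hc, leftPart_of_isDiagonal P hd]
  exact signedShift_commute fun g => by rw [add_zero, add_comm]

lemma commutationMatrix_of_not_isDiagonal {c d : Cut n} (hc : ¬ c.IsDiagonal)
    (hd : ¬ d.IsDiagonal) : commutationMatrix P c d = 0 := by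
  refine if_pos ?_
  rw [leftPart_of_not_isDiagonal P hc, leftPart_of_not_isDiagonal P hd]
  refine signedShift_commute fun g => ?_
  have hne : (-1 : ℤ) ≠ 0 := by decide
  simp only [curry_add_single, Pi.single_eq_of_ne hne, Pi.single_eq_same, add_zero, mulVec_add,
    add_vecMul, Pi.add_apply, mulVec_single_one, single_one_vecMul, col_apply, row_apply]
  ring

theorem irrepDim_mul_rank_le {D : ℕ} {U : Cut n → GL (Fin D) ℂ} (hU : IsVirtualAlgebra P U)
    {T : MPSTensor n D} (hT : ∀ c : Cut n, c.pos = 1 → ∀ g,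
      localAction P c.1 1 T g = T g * (U c : Matrix (Fin D) (Fin D) ℂ))
    (g : Fin (n + 1) → ZMod 2) : irrepDim P * (T g).rank ≤ D := by
  classical
  set b := (commutationMatrix P).toBlock Cut.IsDiagonal (¬ Cut.IsDiagonal ·)
  have hrank : (commutationMatrix P).rank ≤ 2 * b.rank :=
    rank_le_two_mul_rank_toBlock (commutationMatrix_isSymm P) Cut.IsDiagonal
      (Matrix.ext fun c d => commutationMatrix_of_isDiagonal P c.2 d.2)
      (Matrix.ext fun c d => commutationMatrix_of_not_isDiagonal P c.2 d.2)
  calc irrepDim P * (T g).rank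
    _ ≤ 2 ^ b.rank * (T g).rank := by
      gcongr
      exact Nat.pow_le_pow_right two_pos (Nat.div_le_of_le_mul hrank)
    _ ≤ Fintype.card (Fin D) := by
      refine pow_rank_mul_rank_le sgn_injective (A := fun c : {c // Cut.IsDiagonal c} => (U c.1).1)
        (B := fun d : {d // ¬ Cut.IsDiagonal d} => (U d.1).1) (fun c d => ?_)
        (fun d => (U d.1).isUnit) (fun c d => ?_)
        (μ := fun c => sgn ((cocycleMatrix P *ᵥ g) c.1.1)) (fun c => sgn_ne_zero _) fun c => ?_
      · have h := hU c.1 d.1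
        rwa [commutationMatrix_of_isDiagonal P c.2 d.2, ZMod.val_zero, pow_zero, one_smul] at h
      · rw [hU d.1 c.1, (commutationMatrix_isSymm P).apply]
        rfl
      · rw [← hT c.1 c.2.pos_eq_one g, localAction_one_apply P T c.2.eq_zero_or_ne_last]
    _ = D := Fintype.card_fin D

end VirtualAlgebra

end CocycleMPS

theorem theorem3_general (n : ℕ) (P : Fin (n + 1) → Fin (n + 1) → ZMod 2) :
    (∀ (D : ℕ) (T : CocycleMPS.MPSTensor n D), CocycleMPS.IsMinimalGroundStateMPS P T →
      ∀ g : Fin (n + 1) → ZMod 2, T g ≠ 0 → (T g).rank = 1) ∧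
    (∀ (D : ℕ) (U : CocycleMPS.Cut n → GL (Fin D) ℂ) (T : CocycleMPS.MPSTensor n D),
      CocycleMPS.IsVirtualAlgebra P U →
      (∀ c : CocycleMPS.Cut n, c.pos = 1 → ∀ g, CocycleMPS.localAction P c.1 1 T g =
        T g * (U c : Matrix (Fin D) (Fin D) ℂ)) →
      ∀ g : Fin (n + 1) → ZMod 2, CocycleMPS.irrepDim P * (T g).rank ≤ D) :=
  ⟨fun _ _ hT _ hg => hT.rank_eq_one hg, fun _ _ _ hU hT g =>
    CocycleMPS.irrepDim_mul_rank_le P hU hT g⟩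

theorem theorem3 (n : ℕ) (P : Fin (n + 1) → Fin (n + 1) → ZMod 2) :
    (∀ (D : ℕ) (T : CocycleMPS.MPSTensor n D), CocycleMPS.IsMinimalGroundStateMPS P T →
      ∀ g : Fin (n + 1) → ZMod 2, T g ≠ 0 → (T g).rank = 1) ∧
    (∀ (U : CocycleMPS.Cut n → GL (Fin (CocycleMPS.irrepDim P)) ℂ)
      (T : CocycleMPS.MPSTensor n (CocycleMPS.irrepDim P)),
      CocycleMPS.IsVirtualAlgebra P U → CocycleMPS.SolvesLinearEquations P U T →
      ∀ g : Fin (n + 1) → ZMod 2, T g ≠ 0 → (T g).rank = 1) := by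
  refine ⟨(theorem3_general n P).1, fun U T hU hT g => CocycleMPS.rank_eq_one_of_le_one_of_ne_zero
    (Nat.le_of_mul_le_mul_left ?_ (pow_pos two_pos _ : 0 < CocycleMPS.irrepDim P))⟩
  exact ((theorem3_general n P).2 _ U T hU hT.first g).trans_eq (mul_one _).symm
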